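/- Throughout, an MDP on finite non-empty sets $S$ (states) and $A$ (actions) with horizon $H$ is undiscounted ($\gamma=1$) and consists of transition probabilities $T(s,a,t,\cdot)$ on $S$ and deterministic rewards $R(s,a,t)\in\mathbb{R}$, for $s\in S$, $a\in A$, $t\in\{0,\dots,H-1\}$; it is stationary if $T$ and $R$ do not depend on $t$. For a policy $\pi:S\times\{0,\dots,H-1\}\to A$ put $V^\pi(\cdot,H)=0$ and $V^\pi(s,t)=R(s,\pi(s,t),t)+\sum_{s'}T(s,\pi(s,t),t,s')V^\pi(s',t+1)$; further $V^\star=\max_\pi V^\pi$ and $Q^\star(s,a,t)=R(s,a,t)+\sum_{s'}T(s,a,t,s')V^\star(s',t+1)$. An algorithm with a generative model knows $S,A,H,R$. At each step, given the history of the triples $(s,a,t)$ sampled so far and the observed next states, it either stops and publishes a table $\hat Q:S\times A\to\mathbb{R}$, or specifies a probability distribution over the triples $(s,a,t)$; in the latter case a triple is drawn from it, a next state $s'\sim T(s,a,t,\cdot)$ is observed, and the process moves on. The sample complexity of a run is the number of samples gathered ($\infty$ if the run never stops). The algorithm is $(\epsilon,\delta)$-PAC on a class $\mathcal{C}$ of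 MDPs with the given $S,A,H$ if on every $M\in\mathcal{C}$, with probability at least $1-\delta$, it stops and publishes a table with $|Q^\star(s,a,0)-\hat Q(s,a)|\le\epsilon$ for all $(s,a)\in S\times A$. Theorem. There are universal constants $c_1>0$, $c_2>0$ with the following property. For all finite sets $S$, $A$ with $|S|\ge 2$ and $|A|\ge 1$ and every horizon $H>200$ there is a stationary MDP $M$ on $S$, $A$ with horizon $H$ and rewards in $[0,1]$ such that for all $\epsilon\in(0,1)$ and $\delta\in(0,0.5)$, for every class $\mathcal{C}$ of MDPs on $S$, $A$ with horizon $H$ that contains all stationary MDPs with rewards in $[0,1]$ (for instance the class of all MDPs, or that of all stationary MDPs), every algorithm that is $(\epsilon,\delta)$-PAC on $\mathcal{C}$ has expected sample complexity on $M$ at least $$\frac{c_1|S||A|H^3}{\epsilon^2}\log\Big(\frac{c_2}{\delta}\Big).$$ -/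

import Mathlib

open scoped ENNReal

noncomputable section

/-- A finite-horizon, undiscounted (`γ = 1`) Markov decision problem `(S, A, T, R, H, 1)`, with
time steps `0, …, H - 1`, possibly time-dependent transition probabilities `T (s, a, t, ·)` and
deterministic, possibly time-dependent rewards `R (s, a, t)`. -/
structure FiniteHorizonMDP (S A : Type*) (H : ℕ) where
  trans : S → A → Fin H → PMF S
  reward : S → A → Fin H → ℝ

namespace FiniteHorizonMDP

variable {S A : Type*} {H : ℕ}

/-- The transition probabilities and the rewards do not depend on the time step. -/
def IsStationary (M : FiniteHorizonMDP S A H) : Prop :=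
  ∀ s a t t', M.trans s a t = M.trans s a t' ∧ M.reward s a t = M.reward s a t'

/-- Each reward is in `[0, 1]`. -/
def HasUnitRewards (M : FiniteHorizonMDP S A H) : Prop :=
  ∀ s a t, M.reward s a t ∈ Set.Icc (0 : ℝ) 1

/-- The value `V^π (s, t)` of the non-stationary policy `π : S × [H] → A`, for `t < H`;
`V^π (·, t) = 0` for `t ≥ H`. -/
def value [Fintype S] (M : FiniteHorizonMDP S A H) (π : S → Fin H → A) (s : S) (t : ℕ) : ℝ :=
  if h : t < H then
    M.reward s (π s ⟨t, h⟩) ⟨t, h⟩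
      + ∑ s', (M.trans s (π s ⟨t, h⟩) ⟨t, h⟩ s').toReal * value M π s' (t + 1)
  else 0
termination_by H - t

/-- The optimal value `V^⋆ (s, t)`. For finite `S` and finite non-empty `A` there are finitely many
policies, so that the supremum is a maximum. -/
def optValue [Fintype S] (M : FiniteHorizonMDP S A H) (s : S) (t : ℕ) : ℝ :=
  ⨆ π : S → Fin H → A, M.value π s t

/-- The optimal action value `Q^⋆ (s, a, t)`, for `t < H` (and `0` for `t ≥ H`). -/
def optQ [Fintype S] (M : FiniteHorizonMDP S A H) (s : S) (a : A) (t : ℕ) : ℝ :=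
  if h : t < H then
    M.reward s a ⟨t, h⟩ + ∑ s', (M.trans s a ⟨t, h⟩ s').toReal * M.optValue s' (t + 1)
  else 0

/-- The table `q` is an `ε`-correct estimate of `Q^⋆ (·, ·, 0)`. -/
def IsCorrectQ [Fintype S] (M : FiniteHorizonMDP S A H) (ε : ℝ) (q : S → A → ℝ) : Prop :=
  ∀ s a, |M.optQ s a 0 - q s a| ≤ ε

end FiniteHorizonMDP

/-- The sampled `(state, action, time step)` triples with the observed next states, the most recent
sample first. -/
abbrev SampleHistory (S A : Type*) (H : ℕ) := List ((S × A × Fin H) × S)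

/-- An algorithm that uses a generative model. It knows the reward function. Given the history it
either stops and publishes a table `Q̂` (`Sum.inl`), or specifies a probability distribution from
which the next `(state, action, time step)` triple is drawn (`Sum.inr`). -/
abbrev GenerativeAlgorithm (S A : Type*) (H : ℕ) :=
  (S → A → Fin H → ℝ) → SampleHistory S A H → (S → A → ℝ) ⊕ PMF (S × A × Fin H)

namespace GenerativeAlgorithm

variable {S A : Type*} {H : ℕ}

/-- The probability that the algorithm, at history `h`, continues and chooses the query `x`. -/
def queryProb (L : GenerativeAlgorithm S A H) (M : FiniteHorizonMDP S A H)
    (h : SampleHistory S A H) (x : S × A × Fin H) : ℝ≥0∞ :=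
  match L M.reward h with
  | Sum.inl _ => 0
  | Sum.inr μ => μ x

/-- The probability that a run of the algorithm on `M` ever has the history `h`. -/
def reachProb (L : GenerativeAlgorithm S A H) (M : FiniteHorizonMDP S A H) :
    SampleHistory S A H → ℝ≥0∞
  | [] => 1
  | (x, s') :: h => reachProb L M h * (queryProb L M h x * M.trans x.1 x.2.1 x.2.2 s')

/-- The probability that a run of the algorithm on `M` stops, with final history `h`. -/
def stopProb (L : GenerativeAlgorithm S A H) (M : FiniteHorizonMDP S A H)
    (h : SampleHistory S A H) : ℝ≥0∞ :=
  match L M.reward h with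
  | Sum.inl _ => reachProb L M h
  | Sum.inr _ => 0

theorem tsum_step (L : GenerativeAlgorithm S A H) (M : FiniteHorizonMDP S A H)
    (h : SampleHistory S A H) :
    (∑' y : (S × A × Fin H) × S, reachProb L M (y :: h)) + stopProb L M h = reachProb L M h := by
  have e : ∑' y : (S × A × Fin H) × S, reachProb L M (y :: h)
      = reachProb L M h * ∑' x, queryProb L M h x := by
    rw [ENNReal.tsum_prod', ← ENNReal.tsum_mul_left]
    refine tsum_congr fun x => ?_
    simp only [reachProb]
    rw [ENNReal.tsum_mul_left, ENNReal.tsum_mul_left, PMF.tsum_coe, mul_one]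
  rw [e]
  unfold stopProb queryProb
  cases L M.reward h with
  | inl q => simp
  | inr μ => simp [PMF.tsum_coe]

theorem tsum_length_succ (f : SampleHistory S A H → ℝ≥0∞) (n : ℕ) :
    (∑' h : SampleHistory S A H, if h.length = n + 1 then f h else 0)
      = ∑' h : SampleHistory S A H, if h.length = n then ∑' y, f (y :: h) else 0 := by
  let c : SampleHistory S A H × ((S × A × Fin H) × S) → SampleHistory S A H := fun z => z.2 :: z.1
  have hc : Function.Injective c := by
    rintro ⟨h, y⟩ ⟨h', y'⟩ e
    simp only [c, List.cons.injEq] at e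
    rw [e.1, e.2]
  rw [← hc.tsum_eq, ENNReal.tsum_prod']
  · refine tsum_congr fun h => ?_
    by_cases e : h.length = n <;> simp [c, e]
  · intro h hh
    cases h with
    | nil => simp at hh
    | cons y h => exact ⟨(h, y), rfl⟩

theorem sum_stop_add_reach (L : GenerativeAlgorithm S A H) (M : FiniteHorizonMDP S A H) (n : ℕ) :
    (∑ k ∈ Finset.range n, ∑' h : SampleHistory S A H, if h.length = k then stopProb L M h else 0)
      + (∑' h : SampleHistory S A H, if h.length = n then reachProb L M h else 0) = 1 := by
  induction n with
  | zero =>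
    rw [Finset.sum_range_zero, zero_add, tsum_eq_single []]
    · simp [reachProb]
    · intro h hh
      simp [List.length_eq_zero_iff, hh]
  | succ n ih =>
    rw [← ih, Finset.sum_range_succ, add_assoc]
    congr 1
    rw [tsum_length_succ, ← ENNReal.tsum_add]
    refine tsum_congr fun h => ?_
    by_cases e : h.length = n
    · simp only [e, if_true]
      rw [add_comm, tsum_step]
    · simp [e]

theorem tsum_stopProb_le_one (L : GenerativeAlgorithm S A H) (M : FiniteHorizonMDP S A H) :
    ∑' h, stopProb L M h ≤ 1 := by
  have e : ∑' h, stopProb L M h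
      = ∑' k : ℕ, ∑' h : SampleHistory S A H, if h.length = k then stopProb L M h else 0 := by
    rw [ENNReal.tsum_comm]
    refine tsum_congr fun h => ?_
    rw [tsum_eq_single h.length]
    · simp
    · intro k hk
      simp [hk.symm]
  rw [e, ENNReal.tsum_eq_iSup_nat]
  exact iSup_le fun n => le_self_add.trans (sum_stop_add_reach L M n).le

/-- The law of the outcome of a run of the algorithm on `M`: `some h` if the run stops with final
history `h`, and `none` if it never stops. -/
def outcomeLaw (L : GenerativeAlgorithm S A H) (M : FiniteHorizonMDP S A H) :
    PMF (Option (SampleHistory S A H)) :=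
  ⟨fun o => o.elim (1 - ∑' h, stopProb L M h) (stopProb L M), by
    classical
    rw [ENNReal.summable.hasSum_iff, ENNReal.tsum_eq_add_tsum_ite none,
      ← (Option.some_injective (SampleHistory S A H)).tsum_eq]
    · simpa using tsub_add_cancel_of_le (tsum_stopProb_le_one L M)
    · intro o ho
      cases o with
      | none => simp at ho
      | some h => exact ⟨h, rfl⟩⟩

/-- The outcomes in which the algorithm has stopped and published an `ε`-correct table. -/
def correctOutcomes [Fintype S] (L : GenerativeAlgorithm S A H) (M : FiniteHorizonMDP S A H)
    (ε : ℝ) : Set (Option (SampleHistory S A H)) :=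
  {o | ∃ h q, o = some h ∧ L M.reward h = Sum.inl q ∧ M.IsCorrectQ ε q}

/-- The algorithm is `(ε, δ)`-PAC, where the input MDPs are those of the class `𝒞`: on each of
them it stops and publishes an `ε`-correct table with probability at least `1 - δ`. -/
def IsPAC [Fintype S] (L : GenerativeAlgorithm S A H) (𝒞 : Set (FiniteHorizonMDP S A H))
    (ε δ : ℝ) : Prop :=
  ∀ M ∈ 𝒞, ENNReal.ofReal (1 - δ) ≤ (outcomeLaw L M).toOuterMeasure (correctOutcomes L M ε)

/-- The number of samples gathered in a run with a given outcome. -/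
def numSamples : Option (SampleHistory S A H) → ℝ≥0∞
  | none => ⊤
  | some h => h.length

/-- The expected sample complexity of the algorithm on `M`. -/
def expectedSamples (L : GenerativeAlgorithm S A H) (M : FiniteHorizonMDP S A H) : ℝ≥0∞ :=
  ∑' o, outcomeLaw L M o * numSamples o

end GenerativeAlgorithm

end

/-!
The hard problem has one absorbing state `s₀` without rewards. Elsewhere every action gives the
reward `1` and keeps the state with probability `p = 1 - 1 / (2 H)`, and leads to `s₀` otherwise
(`survival`). All policies have the same value, a geometric sum in `p`. Raising `p` to
`q = p + 16 ε / H ^ 2` at a single pair `(s, a)` gives another admissible problem with the same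
rewards, in which the policy that always takes `a` shows that `Q^⋆ (s, a, 0)` is larger by more than
`2 ε`: the derivative of the geometric sum is of order `H ^ 2` (`geom_sum_add_le`). So no table is
correct for both problems, and a PAC algorithm has to tell them apart. The `χ²`-divergence of the
two transition laws at `(s, a)` is of order `κ = ε ^ 2 / H ^ 3`, whence `(s, a)` has to be sampled
at least of order `log (1 / δ) / κ` times. Summing over the `(|S| - 1) |A| ≥ |S| |A| / 2` pairs with
`s ≠ s₀` gives the bound.

The number of samples is random, and possibly unbounded, and it is handled as follows
(`log_le_of_tsum_numVisits_le`). Let `T` and `T'` be the two transition laws. At `(s, a)` the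
weights `T ^ 2 / T'` have the sum `c = 1 + χ²`, so that `T'' = T ^ 2 / (T' c)` are transition
probabilities again, those of a third problem. Since the queries have the same probabilities in all
problems, the probabilities of a terminal history `h` with `n` samples at `(s, a)` satisfy
`P h ^ 2 ≤ P' h * P'' h * c ^ n` (`stopProb_sq_le`). On the event that the table is correct for the
first problem and that `n ≤ 4 F`, with `F` a bound for the expectation of `n`, Cauchy–Schwarz and
`∑ P'' ≤ 1` bound the square of the probability by `δ * exp (4 κ F)`, while Markov's inequality
bounds it from below by a constant. This replaces Wald's identity for the Kullback–Leibler
divergence, and needs no integrability.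
-/

/-! ### Changing the measure of an adaptive sampling process -/

namespace GenerativeAlgorithm

variable {S A : Type*} {H : ℕ}

open scoped Classical in
/-- The number of samples in a history that were taken at the state-action pair `(s, a)`, at any
time step. -/
noncomputable def numVisits (s : S) (a : A) (h : SampleHistory S A H) : ℕ :=
  h.countP fun e => e.1.1 = s ∧ e.1.2.1 = a

theorem sum_numVisits [Fintype S] [Fintype A] (h : SampleHistory S A H) :
    ∑ s : S, ∑ a : A, numVisits s a h = h.length := by
  classical
  induction h with
  | nil => simp [numVisits]
  | cons e h ih =>
    obtain ⟨⟨s, a, t⟩, s'⟩ := e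
    simp only [numVisits, List.countP_cons, Finset.sum_add_distrib, List.length_cons] at ih ⊢
    rw [ih]
    congr 1
    rw [Finset.sum_eq_single s]
    · simp
    · intro b _ hb
      simp [hb.symm]
    · simp

open scoped Classical in
/-- The queries of the algorithm have the same probabilities in all three problems, so that only the
transition probabilities enter the comparison. -/
theorem reachProb_sq_le (L : GenerativeAlgorithm S A H) {M M' M'' : FiniteHorizonMDP S A H}
    (hr' : M'.reward = M.reward) (hr'' : M''.reward = M.reward) {s : S} {a : A} {c : ℝ≥0∞}
    (hT : ∀ x b t y, M.trans x b t y ^ 2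
      ≤ M'.trans x b t y * M''.trans x b t y * (if x = s ∧ b = a then c else 1))
    (h : SampleHistory S A H) :
    reachProb L M h ^ 2 ≤ reachProb L M' h * reachProb L M'' h * c ^ numVisits s a h := by
  induction h with
  | nil => simp [reachProb, numVisits]
  | cons e h ih =>
    obtain ⟨⟨x, b, t⟩, y⟩ := e
    have hq' : queryProb L M' h (x, b, t) = queryProb L M h (x, b, t) := by
      simp only [queryProb, hr']
    have hq'' : queryProb L M'' h (x, b, t) = queryProb L M h (x, b, t) := by
      simp only [queryProb, hr'']
    have hn : c ^ numVisits s a (((x, b, t), y) :: h)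
        = c ^ numVisits s a h * (if x = s ∧ b = a then c else 1) := by
      simp only [numVisits, List.countP_cons, pow_add]
      by_cases hx : x = s ∧ b = a <;> simp [hx]
    simp only [reachProb, hq', hq'', hn]
    calc (reachProb L M h * (queryProb L M h (x, b, t) * M.trans x b t y)) ^ 2
        = reachProb L M h ^ 2 * queryProb L M h (x, b, t) ^ 2 * M.trans x b t y ^ 2 := by ring
      _ ≤ (reachProb L M' h * reachProb L M'' h * c ^ numVisits s a h)
            * queryProb L M h (x, b, t) ^ 2
            * (M'.trans x b t y * M''.trans x b t y * (if x = s ∧ b = a then c else 1)) := by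
          gcongr
          exact hT x b t y
      _ = _ := by ring

open scoped Classical in
theorem stopProb_sq_le (L : GenerativeAlgorithm S A H) {M M' M'' : FiniteHorizonMDP S A H}
    (hr' : M'.reward = M.reward) (hr'' : M''.reward = M.reward) {s : S} {a : A} {c : ℝ≥0∞}
    (hT : ∀ x b t y, M.trans x b t y ^ 2
      ≤ M'.trans x b t y * M''.trans x b t y * (if x = s ∧ b = a then c else 1))
    (h : SampleHistory S A H) :
    stopProb L M h ^ 2 ≤ stopProb L M' h * stopProb L M'' h * c ^ numVisits s a h := by
  have := reachProb_sq_le L hr' hr'' hT h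
  unfold stopProb
  rw [hr', hr'']
  cases L M.reward h with
  | inl q => exact this
  | inr μ => simp

theorem stopProb_le_one (L : GenerativeAlgorithm S A H) (M : FiniteHorizonMDP S A H)
    (h : SampleHistory S A H) : stopProb L M h ≤ 1 :=
  (ENNReal.le_tsum h).trans (tsum_stopProb_le_one L M)

/-- The two cases are a sample count below four times its mean, where the Cauchy–Schwarz bound is
used in its additive form, and one above, where Markov's inequality is. -/
theorem le_add_add_of_sq_le {x y z c κ δ F : ℝ} (hx : 0 ≤ x) (hy : 0 ≤ y) (hz : 0 ≤ z)
    (hc : 0 ≤ c) (hcκ : c ≤ Real.exp κ) (hκ : 0 ≤ κ) (hδ : 0 < δ) (hF : 0 < F) (n : ℕ)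
    (h : x ^ 2 ≤ y * z * c ^ n) :
    x ≤ 1 / (8 * δ) * y + 2 * δ * Real.exp (4 * κ * F) * z + 1 / (4 * F) * (x * n) := by
  rcases le_or_gt (n : ℝ) (4 * F) with hn | hn
  · -- The weights `1 / (8 δ)` and `2 δ` have the product `1 / 4`, which the inequality between
    -- the means needs; the first makes an event of probability `δ` contribute only `1 / 8`.
    have hB : c ^ n ≤ Real.exp (4 * κ * F) := by
      calc c ^ n ≤ Real.exp κ ^ n := by gcongr
        _ = Real.exp (n * κ) := (Real.exp_nat_mul _ _).symm
        _ ≤ _ := by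
          apply Real.exp_le_exp.2
          nlinarith
    have hu : 0 ≤ 1 / (8 * δ) * y := by positivity
    have hv : 0 ≤ 2 * δ * Real.exp (4 * κ * F) * z := by positivity
    have huv : 4 * (1 / (8 * δ) * y) * (2 * δ * Real.exp (4 * κ * F) * z)
        = y * z * Real.exp (4 * κ * F) := by
      field_simp
      ring
    have hle : y * z * c ^ n ≤ y * z * Real.exp (4 * κ * F) := by gcongr
    have hw : 0 ≤ 1 / (4 * F) * (x * n) := by positivity
    have : x ≤ 1 / (8 * δ) * y + 2 * δ * Real.exp (4 * κ * F) * z := by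
      apply le_of_sq_le_sq _ (by positivity)
      nlinarith [sq_nonneg (1 / (8 * δ) * y - 2 * δ * Real.exp (4 * κ * F) * z)]
    linarith
  · have : x ≤ 1 / (4 * F) * (x * n) := by
      rw [div_mul_eq_mul_div, one_mul, le_div_iff₀ (by positivity)]
      gcongr
    have hu : 0 ≤ 1 / (8 * δ) * y := by positivity
    have hv : 0 ≤ 2 * δ * Real.exp (4 * κ * F) * z := by positivity
    linarith

open scoped Classical in
/-- If an event of terminal histories has probability at least `1 - δ` under `M` and at most `δ`
under `M'`, and the two problems differ only at `(s, a)`, where the second moment of their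
likelihood ratio is at most `c ≤ exp κ`, then `(s, a)` is sampled at least of order
`log (1 / δ) / κ` times in expectation under `M`. The moment bound is expressed by the existence of
the problem `M''`, whose transition probabilities are proportional to `T ^ 2 / T'` in the tight
case. -/
theorem log_le_of_tsum_numVisits_le (L : GenerativeAlgorithm S A H)
    {M M' M'' : FiniteHorizonMDP S A H}
    (hr' : M'.reward = M.reward) (hr'' : M''.reward = M.reward) {s : S} {a : A} {c κ δ F : ℝ}
    (hc : 0 ≤ c) (hcκ : c ≤ Real.exp κ) (hκ : 0 ≤ κ)
    (hT : ∀ x b t y, M.trans x b t y ^ 2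
      ≤ M'.trans x b t y * M''.trans x b t y * (if x = s ∧ b = a then ENNReal.ofReal c else 1))
    (hδ : 0 < δ) (hδ' : δ < 1 / 2) (hF : 0 < F) {E : Set (SampleHistory S A H)}
    (hE : ENNReal.ofReal (1 - δ) ≤ ∑' h, E.indicator (stopProb L M) h)
    (hE' : ∑' h, E.indicator (stopProb L M') h ≤ ENNReal.ofReal δ)
    (hN : ∑' h, stopProb L M h * numVisits s a h ≤ ENNReal.ofReal F) :
    Real.log (1 / 16 / δ) ≤ 4 * κ * F := by
  set B := Real.exp (4 * κ * F) with hB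
  have hpt : ∀ h, E.indicator (stopProb L M) h
      ≤ ENNReal.ofReal (1 / (8 * δ)) * E.indicator (stopProb L M') h
        + ENNReal.ofReal (2 * δ * B) * stopProb L M'' h
        + ENNReal.ofReal (1 / (4 * F)) * (stopProb L M h * numVisits s a h) := by
    intro h
    by_cases hh : h ∈ E
    · simp only [Set.indicator_of_mem hh]
      have hsq := stopProb_sq_le L hr' hr'' hT h
      have ne : ∀ N : FiniteHorizonMDP S A H, stopProb L N h ≠ ⊤ := fun N =>
        ((stopProb_le_one L N h).trans_lt ENNReal.one_lt_top).ne
      rw [← ENNReal.ofReal_toReal (ne M), ← ENNReal.ofReal_toReal (ne M'),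
        ← ENNReal.ofReal_toReal (ne M'')] at hsq ⊢
      generalize hx : (stopProb L M h).toReal = x at hsq ⊢
      generalize hy : (stopProb L M' h).toReal = y at hsq ⊢
      generalize hz : (stopProb L M'' h).toReal = z at hsq ⊢
      have hx0 : 0 ≤ x := hx ▸ ENNReal.toReal_nonneg
      have hy0 : 0 ≤ y := hy ▸ ENNReal.toReal_nonneg
      have hz0 : 0 ≤ z := hz ▸ ENNReal.toReal_nonneg
      rw [← ENNReal.ofReal_pow hx0, ← ENNReal.ofReal_pow hc, ← ENNReal.ofReal_mul hy0,
        ← ENNReal.ofReal_mul (by positivity), ENNReal.ofReal_le_ofReal_iff (by positivity)] at hsq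
      rw [← ENNReal.ofReal_natCast, ← ENNReal.ofReal_mul hx0, ← ENNReal.ofReal_mul (by positivity),
        ← ENNReal.ofReal_mul (by positivity), ← ENNReal.ofReal_mul (by positivity),
        ← ENNReal.ofReal_add (by positivity) (by positivity),
        ← ENNReal.ofReal_add (by positivity) (by positivity)]
      exact ENNReal.ofReal_le_ofReal
        (le_add_add_of_sq_le hx0 hy0 hz0 hc hcκ hκ hδ hF _ hsq)
    · simp [hh]
  have hsum := hE.trans (ENNReal.tsum_le_tsum hpt)
  rw [ENNReal.tsum_add, ENNReal.tsum_add, ENNReal.tsum_mul_left, ENNReal.tsum_mul_left,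
    ENNReal.tsum_mul_left] at hsum
  have hle : ENNReal.ofReal (1 - δ) ≤ ENNReal.ofReal (1 / (8 * δ)) * ENNReal.ofReal δ
      + ENNReal.ofReal (2 * δ * B) * 1 + ENNReal.ofReal (1 / (4 * F)) * ENNReal.ofReal F := by
    refine hsum.trans ?_
    gcongr
    exact tsum_stopProb_le_one L M''
  have hB0 : 0 < B := Real.exp_pos _
  rw [mul_one, ← ENNReal.ofReal_mul (by positivity), ← ENNReal.ofReal_mul (by positivity),
    ← ENNReal.ofReal_add (by positivity) (by positivity),
    ← ENNReal.ofReal_add (by positivity) (by positivity),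
    ENNReal.ofReal_le_ofReal_iff (by positivity)] at hle
  have e1 : 1 / (8 * δ) * δ = 1 / 8 := by field_simp
  have e2 : 1 / (4 * F) * F = 1 / 4 := by field_simp
  rw [e1, e2] at hle
  rw [Real.log_le_iff_le_exp (by positivity), ← hB, div_le_iff₀ hδ]
  linarith

/-- The final histories at which the algorithm publishes an `ε`-correct table for `M`. -/
def correctHistories [Fintype S] (L : GenerativeAlgorithm S A H) (M : FiniteHorizonMDP S A H)
    (ε : ℝ) : Set (SampleHistory S A H) :=
  {h | ∃ q, L M.reward h = Sum.inl q ∧ M.IsCorrectQ ε q}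

theorem toOuterMeasure_correctOutcomes [Fintype S] (L : GenerativeAlgorithm S A H)
    (M : FiniteHorizonMDP S A H) (ε : ℝ) :
    (outcomeLaw L M).toOuterMeasure (correctOutcomes L M ε)
      = ∑' h, (correctHistories L M ε).indicator (stopProb L M) h := by
  rw [PMF.toOuterMeasure_apply, ← (Option.some_injective (SampleHistory S A H)).tsum_eq]
  · refine tsum_congr fun h => ?_
    by_cases hh : h ∈ correctHistories L M ε
    · have ho : some h ∈ correctOutcomes L M ε := by
        obtain ⟨q, hq⟩ := hh
        exact ⟨h, q, rfl, hq⟩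
      rw [Set.indicator_of_mem hh, Set.indicator_of_mem ho]
      rfl
    · have ho : some h ∉ correctOutcomes L M ε := by
        rintro ⟨h', q, e, hq⟩
        cases e
        exact hh ⟨q, hq⟩
      rw [Set.indicator_of_notMem hh, Set.indicator_of_notMem ho]
  · intro o ho
    cases o with
    | none => exact (ho (Set.indicator_of_notMem (by rintro ⟨h, q, e, _⟩; cases e) _)).elim
    | some h => exact ⟨h, rfl⟩

/-- Correctness for a problem with the same rewards and a distant `Q^⋆` excludes correctness for
`M`. -/
theorem tsum_indicator_correctHistories_le [Fintype S] (L : GenerativeAlgorithm S A H)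
    {M M' : FiniteHorizonMDP S A H} (hr' : M'.reward = M.reward) {ε δ : ℝ} {s : S} {a : A}
    (hQ : M.optQ s a 0 + 2 * ε < M'.optQ s a 0) (hδ : 0 < δ) (hδ' : δ < 1)
    (hE : ENNReal.ofReal (1 - δ) ≤ (outcomeLaw L M').toOuterMeasure (correctOutcomes L M' ε)) :
    ∑' h, (correctHistories L M ε).indicator (stopProb L M') h ≤ ENNReal.ofReal δ := by
  rw [toOuterMeasure_correctOutcomes] at hE
  have hdisj : ∀ h, (correctHistories L M ε).indicator (stopProb L M') h
      + (correctHistories L M' ε).indicator (stopProb L M') h ≤ stopProb L M' h := by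
    intro h
    by_cases h1 : h ∈ correctHistories L M ε
    · by_cases h2 : h ∈ correctHistories L M' ε
      · obtain ⟨q, e, hq⟩ := h1
        obtain ⟨q', e', hq'⟩ := h2
        rw [hr', e] at e'
        cases e'
        have b1 := abs_le.1 (hq s a)
        have b2 := abs_le.1 (hq' s a)
        exact absurd hQ (by linarith [b1.1, b2.2])
      · simp [h1, h2]
    · simpa [h1] using Set.indicator_le_self _ _ h
  have hle := (ENNReal.tsum_le_tsum hdisj).trans (tsum_stopProb_le_one L M')
  rw [ENNReal.tsum_add] at hle
  have hle' := (add_le_add_right hE _).trans hle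
  have e : (1 : ℝ≥0∞) = ENNReal.ofReal δ + ENNReal.ofReal (1 - δ) := by
    rw [← ENNReal.ofReal_add hδ.le (by linarith)]
    simp
  rw [e] at hle'
  exact (ENNReal.add_le_add_iff_right ENNReal.ofReal_ne_top).1 hle'

theorem sum_tsum_numVisits_le_expectedSamples [Fintype S] [Fintype A]
    (L : GenerativeAlgorithm S A H) (M : FiniteHorizonMDP S A H) :
    ∑ s : S, ∑ a : A, ∑' h, stopProb L M h * numVisits s a h ≤ expectedSamples L M := by
  calc ∑ s : S, ∑ a : A, ∑' h, stopProb L M h * numVisits s a h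
      = ∑' h, stopProb L M h * (h.length : ℝ≥0∞) := by
        simp_rw [← sum_numVisits, Nat.cast_sum, Finset.mul_sum]
        rw [Summable.tsum_finsetSum fun _ _ => ENNReal.summable]
        refine Finset.sum_congr rfl fun s _ => ?_
        rw [Summable.tsum_finsetSum fun _ _ => ENNReal.summable]
    _ ≤ expectedSamples L M :=
        ENNReal.tsum_comp_le_tsum_of_injective (Option.some_injective _)
          fun o => outcomeLaw L M o * numSamples o

end GenerativeAlgorithm

/-! ### Decision problems with one absorbing state -/

namespace FiniteHorizonMDP

variable {S A : Type*} {H : ℕ}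

open scoped Classical in
/-- The stationary problem in which the action `b` at the state `x` leaves the state unchanged with
probability `θ x b` and leads to `s₀` otherwise. The state `s₀` is absorbing, because its two
outcomes coincide. Each step in a state other than `s₀` gives the reward `1`. -/
noncomputable def survival [Fintype S] (H : ℕ) (s₀ : S) (θ : S → A → unitInterval) :
    FiniteHorizonMDP S A H where
  trans x b _ := PMF.ofFintype
    (fun y => ENNReal.ofReal
      ((if y = x then (θ x b : ℝ) else 0) + (if y = s₀ then 1 - (θ x b : ℝ) else 0)))
    (by
      have h0 := (θ x b).2.1
      have h1 := sub_nonneg.2 (θ x b).2.2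
      rw [← ENNReal.ofReal_sum_of_nonneg]
      · simp [Finset.sum_add_distrib]
      · intro y _
        positivity)
  reward x _ _ := if x = s₀ then 0 else 1

theorem survival_isStationary [Fintype S] (s₀ : S) (θ : S → A → unitInterval) :
    (survival H s₀ θ).IsStationary :=
  fun _ _ _ _ => ⟨rfl, rfl⟩

theorem survival_hasUnitRewards [Fintype S] (s₀ : S) (θ : S → A → unitInterval) :
    (survival H s₀ θ).HasUnitRewards := by
  intro x b t
  simp only [survival]
  split_ifs <;> simp

open scoped Classical in
theorem survival_trans_apply [Fintype S] (s₀ : S) (θ : S → A → unitInterval) (x : S) (b : A)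
    (t : Fin H) (y : S) : (survival H s₀ θ).trans x b t y = ENNReal.ofReal
      ((if y = x then (θ x b : ℝ) else 0) + (if y = s₀ then 1 - (θ x b : ℝ) else 0)) :=
  rfl

theorem survival_sum_trans_mul [Fintype S] (s₀ : S) (θ : S → A → unitInterval) (x : S) (b : A)
    (t : Fin H) (f : S → ℝ) : ∑ y, ((survival H s₀ θ).trans x b t y).toReal * f y
      = θ x b * f x + (1 - θ x b) * f s₀ := by
  classical
  have h0 := (θ x b).2.1
  have h1 := sub_nonneg.2 (θ x b).2.2
  simp_rw [survival_trans_apply]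
  have e : ∀ y, (ENNReal.ofReal
      ((if y = x then (θ x b : ℝ) else 0) + (if y = s₀ then 1 - (θ x b : ℝ) else 0))).toReal
      = (if y = x then (θ x b : ℝ) else 0) + (if y = s₀ then 1 - (θ x b : ℝ) else 0) :=
    fun y => ENNReal.toReal_ofReal (by positivity)
  simp [e, add_mul, Finset.sum_add_distrib]

theorem survival_value_absorbing [Fintype S] (s₀ : S) (θ : S → A → unitInterval)
    (π : S → Fin H → A) (n : ℕ) :
    ∀ t, t + n = H → (survival H s₀ θ).value π s₀ t = 0 := by
  induction n with
  | zero =>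
    intro t ht
    rw [value, dif_neg (by omega)]
  | succ n ih =>
    intro t ht
    rw [value, dif_pos (by omega), survival_sum_trans_mul, ih (t + 1) (by omega)]
    simp [survival]

theorem survival_value [Fintype S] {s₀ s : S} (hs : s ≠ s₀) (θ : S → A → unitInterval)
    (π : S → Fin H → A) {p : ℝ} (hπ : ∀ t, (θ s (π s t) : ℝ) = p) (n : ℕ) :
    ∀ t, t + n = H → (survival H s₀ θ).value π s t = ∑ k ∈ Finset.range n, p ^ k := by
  induction n with
  | zero =>
    intro t ht
    rw [value, dif_neg (by omega)]
    simp
  | succ n ih =>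
    intro t ht
    rw [value, dif_pos (by omega), survival_sum_trans_mul, ih (t + 1) (by omega), hπ,
      survival_value_absorbing s₀ θ π n (t + 1) (by omega), geom_sum_succ]
    simp [survival, hs, add_comm]

theorem survival_optValue_absorbing [Fintype S] [Nonempty A] (s₀ : S) (θ : S → A → unitInterval)
    {n t : ℕ} (ht : t + n = H) : (survival H s₀ θ).optValue s₀ t = 0 := by
  rw [optValue]
  simp_rw [fun π => survival_value_absorbing s₀ θ π n t ht]
  exact ciSup_const

theorem survival_optQ_const [Fintype S] [Nonempty A] {s₀ s : S} (hs : s ≠ s₀) (p : unitInterval)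
    (a : A) (hH : 0 < H) :
    (survival H s₀ fun _ _ => p).optQ s a 0 = ∑ k ∈ Finset.range H, (p : ℝ) ^ k := by
  obtain ⟨n, rfl⟩ : ∃ n, H = n + 1 := ⟨H - 1, by omega⟩
  have hv : (survival (n + 1) s₀ fun (_ : S) (_ : A) => p).optValue s 1
      = ∑ k ∈ Finset.range n, (p : ℝ) ^ k := by
    rw [optValue]
    simp_rw [fun π => survival_value hs (fun (_ : S) (_ : A) => p) π (fun _ => rfl) n 1
      (add_comm 1 n)]
    exact ciSup_const
  rw [optQ, dif_pos hH, survival_sum_trans_mul, zero_add, hv,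
    survival_optValue_absorbing s₀ _ (add_comm 1 n), geom_sum_succ]
  simp [survival, hs, add_comm]

/-- The right-hand side is the value of the policy that always takes the action `a`. -/
theorem le_survival_optQ [Fintype S] [Finite A] {s₀ s : S} (hs : s ≠ s₀) (θ : S → A → unitInterval)
    (a : A) (hH : 0 < H) :
    ∑ k ∈ Finset.range H, (θ s a : ℝ) ^ k ≤ (survival H s₀ θ).optQ s a 0 := by
  have : Nonempty A := ⟨a⟩
  obtain ⟨n, rfl⟩ : ∃ n, H = n + 1 := ⟨H - 1, by omega⟩
  have hv : ∑ k ∈ Finset.range n, (θ s a : ℝ) ^ k ≤ (survival (n + 1) s₀ θ).optValue s 1 := by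
    rw [← survival_value hs θ (fun _ _ => a) (fun _ => rfl) n 1 (add_comm 1 n), optValue]
    exact le_ciSup (f := fun π => (survival (n + 1) s₀ θ).value π s 1)
      (Set.finite_range _).bddAbove _
  rw [optQ, dif_pos hH, survival_sum_trans_mul, zero_add,
    survival_optValue_absorbing s₀ _ (add_comm 1 n), geom_sum_succ]
  have := mul_le_mul_of_nonneg_left hv (θ s a).2.1
  have hr : (survival (n + 1) s₀ θ).reward s a ⟨0, hH⟩ = 1 := if_neg hs
  rw [hr]
  linarith

open scoped Classical in
/-- The comparison of transition probabilities that the change of measure needs, for three problems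
`survival H s₀ θ` that differ at the pair `(s, a)` only: it reduces to the two outcomes there. -/
theorem survival_trans_sq_le [Fintype S] {s₀ s : S} (hs : s ≠ s₀) (a : A) (p p' p'' : unitInterval)
    {c : ℝ} (h1 : (p : ℝ) ^ 2 ≤ p' * p'' * c)
    (h2 : (1 - p : ℝ) ^ 2 ≤ (1 - p') * (1 - p'') * c) (x : S) (b : A) (t : Fin H) (y : S) :
    (survival H s₀ fun _ _ => p).trans x b t y ^ 2
      ≤ (survival H s₀ fun x b => if x = s ∧ b = a then p' else p).trans x b t y
        * (survival H s₀ fun x b => if x = s ∧ b = a then p'' else p).trans x b t y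
        * (if x = s ∧ b = a then ENNReal.ofReal c else 1) := by
  simp only [survival_trans_apply]
  by_cases hx : x = s ∧ b = a
  · simp only [hx, and_self, if_true]
    have a0 := p.2.1
    have a1 := sub_nonneg.2 p.2.2
    have b0 := p'.2.1
    have b1 := sub_nonneg.2 p'.2.2
    have c0 := p''.2.1
    have c1 := sub_nonneg.2 p''.2.2
    rw [← ENNReal.ofReal_pow (by positivity), ← ENNReal.ofReal_mul (by positivity),
      ← ENNReal.ofReal_mul (by positivity)]
    apply ENNReal.ofReal_le_ofReal
    by_cases hy : y = s
    · simpa [hy, hs] using h1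
    · by_cases hy' : y = s₀
      · simpa [hy', hs.symm] using h2
      · simp [hy, hy']
  · simp only [hx, if_false, mul_one]
    rw [sq]

end FiniteHorizonMDP

/-! ### The gap between the values and the second moment of the likelihood ratio -/

/-- The gap is quadratic in the horizon, since the survival probability `p` is so large that all
summands `k * p ^ (k - 1)` of the derivative are of order `k`. -/
theorem geom_sum_add_le {H : ℕ} {p q : ℝ} (hp : p = 1 - 1 / (2 * H)) (hpq : p ≤ q) (hH : 0 < H) :
    ∑ k ∈ Finset.range H, p ^ k + (q - p) / 2 * (H * (H - 1) / 2)
      ≤ ∑ k ∈ Finset.range H, q ^ k := by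
  have hH' : (1 : ℝ) ≤ H := by exact_mod_cast hH
  have hp2 : 1 / 2 ≤ p := by
    rw [hp, le_sub_comm, div_le_iff₀ (by positivity)]
    linarith
  have hp1 : p ≤ 1 := by
    rw [hp]
    have : 0 ≤ 1 / (2 * (H : ℝ)) := by positivity
    linarith
  have hid : ∀ n : ℕ, ∑ k ∈ Finset.range n, (k : ℝ) = n * (n - 1) / 2 := by
    intro n
    induction n with
    | zero => simp
    | succ n ih =>
      rw [Finset.sum_range_succ, ih]
      push_cast
      ring
  rw [← hid H, Finset.mul_sum, ← Finset.sum_add_distrib]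
  refine Finset.sum_le_sum fun k hk => ?_
  have hkH : (k : ℝ) ≤ H := by exact_mod_cast (Finset.mem_range.1 hk).le
  have hpk : 1 / 2 ≤ p ^ k := by
    refine le_trans ?_ (one_add_mul_sub_le_pow (by linarith) k)
    have : (k : ℝ) * (1 / (2 * H)) ≤ 1 / 2 := by
      rw [mul_one_div, div_le_iff₀ (by positivity)]
      linarith
    rw [hp]
    linarith
  have hr : q - p ≤ q / p - 1 := by
    rw [div_sub_one (by positivity), le_div_iff₀ (by positivity)]
    nlinarith
  have hb : 1 + k * (q - p) ≤ (q / p) ^ k := by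
    refine le_trans ?_ (one_add_mul_sub_le_pow (by linarith) k)
    gcongr
  calc p ^ k + (q - p) / 2 * k ≤ p ^ k * (1 + k * (q - p)) := by
        have : 0 ≤ k * (q - p) := mul_nonneg k.cast_nonneg (by linarith)
        nlinarith
    _ ≤ p ^ k * (q / p) ^ k := by gcongr
    _ = q ^ k := by
        rw [← mul_pow, mul_div_cancel₀ _ (by positivity)]

/-- For Bernoulli laws, the second moment of the likelihood ratio exceeds `1` by the `χ²`-divergence
`(p - q) ^ 2 / (q * (1 - q))`. The law with the parameter `r` is the corresponding tilted one. -/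
theorem exists_tilted_parameter {p q κ : ℝ} (hq : q ∈ Set.Ioo (0 : ℝ) 1)
    (hκ : (p - q) ^ 2 / (q * (1 - q)) ≤ κ) :
    ∃ (r : unitInterval) (c : ℝ), 0 ≤ c ∧ c ≤ Real.exp κ ∧ p ^ 2 ≤ q * r * c ∧
      (1 - p) ^ 2 ≤ (1 - q) * (1 - r) * c := by
  have q0 := hq.1
  have q1 : 0 < 1 - q := sub_pos.2 hq.2
  set c := 1 + (p - q) ^ 2 / (q * (1 - q)) with hc
  have hc0 : 0 < c := by positivity
  have key : p ^ 2 * (1 - q) + (1 - p) ^ 2 * q = q * (1 - q) * c := by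
    rw [hc]
    field_simp
    ring
  have hr : 1 - p ^ 2 / (q * c) = (1 - p) ^ 2 / ((1 - q) * c) := by
    field_simp
    linarith
  refine ⟨⟨p ^ 2 / (q * c), by positivity, sub_nonneg.1 ?_⟩, c, hc0.le, ?_, ?_, ?_⟩
  · rw [hr]
    positivity
  · linarith [Real.add_one_le_exp κ]
  · apply le_of_eq
    field_simp
  · apply le_of_eq
    simp only [hr]
    field_simp

open FiniteHorizonMDP

/-! ### The lower bound -/

/-- The alternative problem raises the survival probability at `(s, a)` by `16 ε / H ^ 2`, which
moves `Q^⋆ (s, a, 0)` by more than `2 ε`. -/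
theorem survival_tsum_numVisits_ge {S A : Type*} [Fintype S] [Fintype A] {H : ℕ} (hH : 200 < H)
    {s₀ s : S} (hs : s ≠ s₀) (a : A) {p : unitInterval} (hp : (p : ℝ) = 1 - 1 / (2 * H)) {ε δ : ℝ}
    (hε : ε ∈ Set.Ioo (0 : ℝ) 1) (hδ : δ ∈ Set.Ioo (0 : ℝ) (1 / 2))
    {𝒞 : Set (FiniteHorizonMDP S A H)}
    (h𝒞 : ∀ M' : FiniteHorizonMDP S A H, M'.IsStationary → M'.HasUnitRewards → M' ∈ 𝒞)
    {L : GenerativeAlgorithm S A H} (hL : L.IsPAC 𝒞 ε δ) :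
    ENNReal.ofReal ((H : ℝ) ^ 3 / (16384 * ε ^ 2) * Real.log (1 / 16 / δ))
      ≤ ∑' h, L.stopProb (survival H s₀ fun _ _ => p) h * GenerativeAlgorithm.numVisits s a h := by
  obtain ⟨ε0, ε1⟩ := hε
  have hHr : (200 : ℝ) < H := by exact_mod_cast hH
  have : Nonempty A := ⟨a⟩
  have hΔ : 16 * ε / (H : ℝ) ^ 2 ≤ 1 / (4 * H) := by
    rw [div_le_div_iff₀ (by positivity) (by positivity)]
    nlinarith
  have hΔ0 : 0 < 16 * ε / (H : ℝ) ^ 2 := by positivity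
  set q : ℝ := p + 16 * ε / (H : ℝ) ^ 2 with hq
  have hH2 : 1 / (2 * (H : ℝ)) = 2 * (1 / (4 * H)) := by
    field_simp
    norm_num
  have hH4 : 1 / (4 * (H : ℝ)) ≤ 1 / 4 := by
    rw [div_le_div_iff₀ (by positivity) (by positivity)]
    linarith
  have hH40 : 0 < 1 / (4 * (H : ℝ)) := by positivity
  have hq1 : 1 / (4 * (H : ℝ)) ≤ 1 - q := by linarith
  have hq2 : 1 / 2 ≤ q := by linarith
  have hqI : q ∈ Set.Ioo (0 : ℝ) 1 := ⟨by linarith, by linarith⟩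
  have hκ : ((p : ℝ) - q) ^ 2 / (q * (1 - q)) ≤ 2048 * ε ^ 2 / (H : ℝ) ^ 3 := by
    have hprod : 1 / 2 * (1 / (4 * (H : ℝ))) ≤ q * (1 - q) := by gcongr
    calc ((p : ℝ) - q) ^ 2 / (q * (1 - q))
        ≤ ((p : ℝ) - q) ^ 2 / (1 / 2 * (1 / (4 * (H : ℝ)))) := by gcongr
      _ = 2048 * ε ^ 2 / (H : ℝ) ^ 3 := by
        rw [hq]
        field_simp
        ring
  obtain ⟨r, c, hc0, hcκ, h1, h2⟩ := exists_tilted_parameter hqI hκ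
  set p' : unitInterval := ⟨q, hqI.1.le, hqI.2.le⟩ with hp'
  classical
  set M : FiniteHorizonMDP S A H := survival H s₀ fun _ _ => p with hM
  set M' : FiniteHorizonMDP S A H :=
    survival H s₀ fun x b => if x = s ∧ b = a then p' else p with hM'
  have hQ : M.optQ s a 0 + 2 * ε < M'.optQ s a 0 := by
    have hge := le_survival_optQ hs (fun x b => if x = s ∧ b = a then p' else p) a
      (show 0 < H by omega)
    simp only [and_self, if_true] at hge
    rw [hM, survival_optQ_const hs p a (by omega)]
    have hgap := geom_sum_add_le hp (show (p : ℝ) ≤ q by linarith) (show 0 < H by omega)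
    have he : 2 * ε < (q - p) / 2 * ((H : ℝ) * (H - 1) / 2) := by
      have : (q - p) / 2 * ((H : ℝ) * (H - 1) / 2) = 4 * ε * (H - 1) / H := by
        rw [hq]
        field_simp
        ring
      rw [this, lt_div_iff₀ (by positivity)]
      nlinarith
    linarith
  -- The constant `16384` leaves a factor `2` to spare, so that a sample count below `X` gives
  -- `log (1 / (16 δ)) ≤ log (1 / (16 δ)) / 2`, where the logarithm is positive because `X` is.
  by_contra! hlt
  set X := (H : ℝ) ^ 3 / (16384 * ε ^ 2) * Real.log (1 / 16 / δ) with hX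
  have hX0 : 0 < X := by
    by_contra! hX0
    rw [ENNReal.ofReal_of_nonpos hX0] at hlt
    exact not_lt_bot hlt
  have hlog := L.log_le_of_tsum_numVisits_le (M := M) (M' := M')
    (M'' := survival H s₀ fun x b => if x = s ∧ b = a then r else p) rfl rfl hc0 hcκ
    (by positivity) (survival_trans_sq_le hs a p p' r h1 h2) hδ.1 hδ.2 hX0
    (E := L.correctHistories M ε)
    (by
      rw [← GenerativeAlgorithm.toOuterMeasure_correctOutcomes]
      exact hL M (h𝒞 M (survival_isStationary _ _) (survival_hasUnitRewards _ _)))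
    (L.tsum_indicator_correctHistories_le (M := M) (M' := M') rfl hQ hδ.1 (by linarith [hδ.2])
      (hL M' (h𝒞 M' (survival_isStationary _ _) (survival_hasUnitRewards _ _))))
    hlt.le
  have e : 4 * (2048 * ε ^ 2 / (H : ℝ) ^ 3) * X = Real.log (1 / 16 / δ) / 2 := by
    rw [hX]
    field_simp
    ring
  have hpos : 0 < Real.log (1 / 16 / δ) := by
    have : 0 < (H : ℝ) ^ 3 / (16384 * ε ^ 2) := by positivity
    exact (pos_iff_pos_of_mul_pos hX0).1 this
  linarith

theorem theorem3 :
    ∃ c₁ c₂ : ℝ, 0 < c₁ ∧ 0 < c₂ ∧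
      ∀ (S A : Type*) [Fintype S] [Fintype A] [Nontrivial S] [Nonempty A] (H : ℕ), 200 < H →
        ∃ M : FiniteHorizonMDP S A H, M.IsStationary ∧ M.HasUnitRewards ∧
          ∀ ε δ : ℝ, ε ∈ Set.Ioo (0 : ℝ) 1 → δ ∈ Set.Ioo (0 : ℝ) (1 / 2) →
          ∀ 𝒞 : Set (FiniteHorizonMDP S A H),
            (∀ M' : FiniteHorizonMDP S A H, M'.IsStationary → M'.HasUnitRewards → M' ∈ 𝒞) →
          ∀ L : GenerativeAlgorithm S A H, L.IsPAC 𝒞 ε δ →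
            ENNReal.ofReal
                (c₁ * Fintype.card S * Fintype.card A * (H : ℝ) ^ 3 / ε ^ 2 * Real.log (c₂ / δ))
              ≤ L.expectedSamples M := by
  refine ⟨1 / 32768, 1 / 16, by norm_num, by norm_num, ?_⟩
  intro S A _ _ _ _ H hH
  classical
  obtain ⟨s₀, -⟩ := exists_pair_ne S
  have hHr : (200 : ℝ) < H := by exact_mod_cast hH
  have hp0 : 0 ≤ 1 - 1 / (2 * (H : ℝ)) := by
    rw [sub_nonneg, div_le_one (by positivity)]
    linarith
  have hp1 : 1 - 1 / (2 * (H : ℝ)) ≤ 1 := sub_le_self _ (by positivity)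
  refine ⟨survival H s₀ fun _ _ => ⟨1 - 1 / (2 * (H : ℝ)), hp0, hp1⟩, survival_isStationary _ _,
    survival_hasUnitRewards _ _, ?_⟩
  intro ε δ hε hδ 𝒞 h𝒞 L hL
  refine le_trans ?_ (L.sum_tsum_numVisits_le_expectedSamples _)
  set X := (H : ℝ) ^ 3 / (16384 * ε ^ 2) * Real.log (1 / 16 / δ) with hX
  have hcard : (2 : ℝ) ≤ Fintype.card S := by
    exact_mod_cast Fintype.one_lt_card (α := S)
  have hε0 := hε.1
  have e : 1 / 32768 * Fintype.card S * Fintype.card A * (H : ℝ) ^ 3 / ε ^ 2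
      * Real.log (1 / 16 / δ) = Fintype.card S * Fintype.card A / 2 * X := by
    rw [hX]
    field_simp
    ring
  rw [e]
  rcases le_or_gt X 0 with hX0 | hX0
  · rw [ENNReal.ofReal_of_nonpos (mul_nonpos_of_nonneg_of_nonpos (by positivity) hX0)]
    exact zero_le
  calc ENNReal.ofReal (Fintype.card S * Fintype.card A / 2 * X)
      ≤ ENNReal.ofReal (((Fintype.card S - 1 : ℕ) : ℝ) * (Fintype.card A * X)) := by
        apply ENNReal.ofReal_le_ofReal
        rw [Nat.cast_sub Fintype.card_pos, Nat.cast_one]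
        have : 0 ≤ Fintype.card A * X := by positivity
        nlinarith
    _ = ∑ s ∈ Finset.univ.erase s₀, ∑ a : A, ENNReal.ofReal X := by
        simp only [Finset.sum_const, Finset.card_erase_of_mem (Finset.mem_univ s₀),
          Finset.card_univ, nsmul_eq_mul]
        rw [ENNReal.ofReal_mul (by positivity), ENNReal.ofReal_mul (by positivity),
          ENNReal.ofReal_natCast, ENNReal.ofReal_natCast]
    _ ≤ ∑ s ∈ Finset.univ.erase s₀, ∑ a : A,
          ∑' h, L.stopProb _ h * GenerativeAlgorithm.numVisits s a h :=
        Finset.sum_le_sum fun s hs => Finset.sum_le_sum fun a _ =>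
          survival_tsum_numVisits_ge hH (Finset.ne_of_mem_erase hs) a rfl hε hδ h𝒞 hL
    _ ≤ _ := Finset.sum_le_sum_of_subset (Finset.erase_subset _ _)
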